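/- **Theorem (Completeness).** Let $\mathcal A$ be an infinite set of atomic propositions, and consider formulae of intuitionistic propositional logic built from atoms and $\bot$ by $\wedge,\vee,\supset$. *Bases and derivations.* An atomic rule has the form $((P_1\Rightarrow q_1),\dots,(P_n\Rightarrow q_n))\Rightarrow r$ with $n\ge 0$, $P_i\subseteq\mathcal A$ finite and $q_i,r\in\mathcal A$; a base is a set of atomic rules. A context $(X\!:\!P)$ is a finite list of typed variables $x_1\!:\!p_1,\dots,x_m\!:\!p_m$ with $p_i\in\mathcal A$. Derivations $(X\!:\!P)\vdash_{\mathcal B}\Phi:p$ in a base $\mathcal B$ are the terms (up to renaming of bound variables) generated by: each variable $x\!:\!p$ of the context is a derivation of $p$; and if $\mathcal R=((P_1\Rightarrow q_1),\dots,(P_n\Rightarrow q_n))\Rightarrow r$ is in $\mathcal B$ and $(X\!:\!P),(X_i\!:\!P_i)\vdash_{\mathcal B}\Phi_i:q_i$ for all $i$, then $(X\!:\!P)\vdash_{\mathcal B}\Phi_{\mathcal R}(\Phi_1,\dots,\Phi_n):r$, the variables $X_i$ (one for each atom of $P_i$) being bound. *Worlds.* Let $\mathcal W$ be the category whose objects are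 the pairs $(\mathcal B,(X\!:\!P))$ of a base and a context; a morphism $(\mathcal B,(X\!:\!P))\to(\mathcal C,(Y\!:\!Q))$ exists only if $\mathcal C\subseteq\mathcal B$, and is then a family of derivations $(X\!:\!P)\vdash_{\mathcal B}\Phi_y:q$, one for each variable $y\!:\!q$ of $(Y\!:\!Q)$. Identities are given by the variables, composition by simultaneous substitution. *Interpretation.* For presheaves $F,G:\mathcal W^{op}\to\mathbf{Set}$ let $F\supset G$ be the exponential, $(F\supset G)(w)=\mathrm{Nat}(\mathcal W(-,w)\times F,G)$; for a family $(K_p)_{p\in\mathcal A}$ of presheaves let $(\forall_{\mathcal A}K)(w)=\prod_{p\in\mathcal A}\mathrm{Nat}(\mathcal W(-,w),K_p)$. Define $[\![\phi]\!]:\mathcal W^{op}\to\mathbf{Set}$ by: $[\![p]\!](\mathcal B,(X\!:\!P))$ is the set of derivations $(X\!:\!P)\vdash_{\mathcal B}\Phi:p$, with morphisms acting by substitution; $[\![\phi\wedge\psi]\!]=[\![\phi]\!]\times[\![\psi]\!]$; $[\![\phi\supset\psi]\!]=[\![\phi]\!]\supset[\![\psi]\!]$; $[\![\phi\vee\psi]\!]=\forall_{\mathcal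 A}K$ with $K_p=([\![\phi]\!]\supset[\![p]\!])\supset(([\![\psi]\!]\supset[\![p]\!])\supset[\![p]\!])$; $[\![\bot]\!]=\forall_{\mathcal A}K$ with $K_p=[\![p]\!]$. For a finite set $\Gamma$ of formulae, $[\![\Gamma]\!]=\prod_{\psi\in\Gamma}[\![\psi]\!]$. Write $\Gamma\models\phi$ if there is a natural transformation $[\![\Gamma]\!]\to[\![\phi]\!]$. *Claim.* For every finite set $\Gamma$ of formulae and every formula $\phi$: if $\Gamma\models\phi$, then $\Gamma\vdash\phi$ is derivable in the intuitionistic natural deduction calculus NJ (hypothesis rule, $\bot$-elimination, and the introduction and elimination rules for $\wedge$, $\vee$, $\supset$). -/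

import Mathlib

universe u

namespace CatPTS

/-! ### Formulae and natural deduction -/

/-- Formulae of intuitionistic propositional logic over a type `A` of atoms. -/
inductive Formula (A : Type u) : Type u
  | atom (p : A) : Formula A
  | bot : Formula A
  | and (φ ψ : Formula A) : Formula A
  | or (φ ψ : Formula A) : Formula A
  | imp (φ ψ : Formula A) : Formula A

/-- `NJ Γ φ`: the sequent `Γ ⊢ φ` is derivable in the natural deduction calculus NJ. -/
inductive NJ {A : Type u} : Set (Formula A) → Formula A → Prop
  | ax {Γ : Set (Formula A)} {φ : Formula A} (h : φ ∈ Γ) : NJ Γ φ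
  | botE {Γ : Set (Formula A)} {φ : Formula A} (h : NJ Γ .bot) : NJ Γ φ
  | andI {Γ : Set (Formula A)} {φ ψ : Formula A} (h₁ : NJ Γ φ) (h₂ : NJ Γ ψ) : NJ Γ (.and φ ψ)
  | andE₁ {Γ : Set (Formula A)} {φ ψ : Formula A} (h : NJ Γ (.and φ ψ)) : NJ Γ φ
  | andE₂ {Γ : Set (Formula A)} {φ ψ : Formula A} (h : NJ Γ (.and φ ψ)) : NJ Γ ψ
  | orI₁ {Γ : Set (Formula A)} {φ ψ : Formula A} (h : NJ Γ φ) : NJ Γ (.or φ ψ)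
  | orI₂ {Γ : Set (Formula A)} {φ ψ : Formula A} (h : NJ Γ ψ) : NJ Γ (.or φ ψ)
  | orE {Γ : Set (Formula A)} {φ ψ χ : Formula A} (h : NJ Γ (.or φ ψ))
      (h₁ : NJ (insert φ Γ) χ) (h₂ : NJ (insert ψ Γ) χ) : NJ Γ χ
  | impI {Γ : Set (Formula A)} {φ ψ : Formula A} (h : NJ (insert φ Γ) ψ) : NJ Γ (.imp φ ψ)
  | impE {Γ : Set (Formula A)} {φ ψ : Formula A} (h₁ : NJ Γ φ) (h₂ : NJ Γ (.imp φ ψ)) : NJ Γ ψ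

/-! ### Bases and derivations in a base -/

/-- An atomic rule `((P₁ ⇒ q₁), …, (Pₙ ⇒ qₙ)) ⇒ r`, with finite sets `Pᵢ` of discharged atoms;
`n = 0` is allowed. -/
structure AtomicRule (A : Type u) : Type u where
  premises : List (Finset A × A)
  conclusion : A

/-- A base is a set of atomic rules. -/
abbrev Base (A : Type u) : Type u := Set (AtomicRule A)

/-- Over countably many atoms every base is countable. -/
theorem Base.countable {A : Type u} [Countable A] (B : Base A) : B.Countable := by
  have : Function.Injective (fun R : AtomicRule A => (R.premises, R.conclusion)) := by
    rintro ⟨a, b⟩ ⟨c, d⟩ h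
    cases h
    rfl
  have := this.countable
  exact Set.to_countable B

/-- `Var c p` is the type of variables of type `p` in the context `c`. A context
`x₁ : p₁, …, xₘ : pₘ` is the list `[p₁, …, pₘ]`, its variables being the positions in the list. -/
inductive Var {A : Type u} : List A → A → Type u
  | here {p : A} {c : List A} : Var (p :: c) p
  | there {p q : A} {c : List A} (x : Var c p) : Var (q :: c) p

/-- `Derivation B c p` is the type of derivation terms `c ⊢_B Φ : p`. In an application of a rule,
the context of the `k`-th premise is extended by one bound variable for every discharged atom. -/
inductive Derivation {A : Type u} (B : Base A) : List A → A → Type u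
  | var {c : List A} {p : A} (x : Var c p) : Derivation B c p
  | app {c : List A} (R : AtomicRule A) (hR : R ∈ B)
      (Φ : ∀ k : Fin R.premises.length,
        Derivation B ((R.premises.get k).1.toList ++ c) (R.premises.get k).2) :
      Derivation B c R.conclusion

/-- A renaming of the variables of `c` by variables of `d`. -/
abbrev Renaming {A : Type u} (c d : List A) : Type u := ∀ p : A, Var c p → Var d p

/-- A renaming extended by the identity on the new variables `l`. -/
def Renaming.lift {A : Type u} {c d : List A} (ρ : Renaming c d) :
    ∀ l : List A, Renaming (l ++ c) (l ++ d)
  | [], p, x => ρ p x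
  | _ :: _, _, .here => .here
  | _ :: l, p, .there x => .there (Renaming.lift ρ l p x)

/-- Capture-avoiding renaming of the free variables of a derivation. -/
noncomputable def Derivation.rename {A : Type u} {B : Base A} : ∀ {c d : List A} {p : A},
    Renaming c d → Derivation B c p → Derivation B d p
  | _, _, _, ρ, .var x => .var (ρ _ x)
  | _, _, _, ρ, .app R hR Φ => .app R hR fun k => (Φ k).rename (ρ.lift _)

/-- A family of derivations in `B` from `c`, one for each variable of `d`. -/
abbrev Substitution {A : Type u} (B : Base A) (c d : List A) : Type u :=
  ∀ p : A, Var d p → Derivation B c p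

/-- A substitution extended by the identity on the new variables `l`. -/
noncomputable def Substitution.lift {A : Type u} {B : Base A} {c d : List A} (σ : Substitution B c d) :
    ∀ l : List A, Substitution B (l ++ c) (l ++ d)
  | [], p, x => σ p x
  | _ :: _, _, .here => .var .here
  | _ :: l, p, .there x => (Substitution.lift σ l p x).rename fun _ => .there

/-- Simultaneous capture-avoiding substitution `Φ[σ]`. A derivation `Φ` in a base `C ⊆ B` is at the
same time read as a derivation in `B`. -/
noncomputable def Derivation.subst {A : Type u} {B C : Base A} (h : C ⊆ B) : ∀ {c d : List A} {p : A},
    Substitution B c d → Derivation C d p → Derivation B c p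
  | _, _, _, σ, .var x => σ _ x
  | _, _, _, σ, .app R hR Φ => .app R (h hR) fun k => (Φ k).subst h (σ.lift _)

/-! ### Substitution laws -/

theorem Renaming.lift_comp {A : Type u} {c d e : List A} (ρ : Renaming c d) (τ : Renaming d e)
    (l : List A) : ∀ (p : A) (x : Var (l ++ c) p),
      τ.lift l p (ρ.lift l p x) = Renaming.lift (fun q y => τ q (ρ q y)) l p x := by
  induction l with
  | nil => intro p x; rfl
  | cons a l ih =>
    intro p x
    cases x with
    | here => rfl
    | there x => exact congrArg Var.there (ih p x)

theorem Derivation.rename_rename {A : Type u} {B : Base A} {c : List A} {p : A}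
    (Φ : Derivation B c p) : ∀ {d e : List A} (ρ : Renaming c d) (τ : Renaming d e),
      (Φ.rename ρ).rename τ = Φ.rename fun q y => τ q (ρ q y) := by
  induction Φ with
  | var x => intros; rfl
  | app R hR Φ ih =>
    intro d e ρ τ
    simp only [Derivation.rename, ih]
    congr 1
    funext k
    congr 1
    funext q y
    exact Renaming.lift_comp ρ τ _ q y

theorem Substitution.lift_rename {A : Type u} {B : Base A} {c d e : List A} (ρ : Renaming e d)
    (σ : Substitution B c d) (l : List A) : ∀ (p : A) (x : Var (l ++ e) p),
      σ.lift l p (ρ.lift l p x) = Substitution.lift (fun q y => σ q (ρ q y)) l p x := by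
  induction l with
  | nil => intro p x; rfl
  | cons a l ih =>
    intro p x
    cases x with
    | here => rfl
    | there x => exact congrArg (Derivation.rename fun _ => Var.there) (ih p x)

theorem Derivation.subst_rename {A : Type u} {B C : Base A} (h : C ⊆ B) {e : List A} {p : A}
    (Φ : Derivation C e p) : ∀ {c d : List A} (ρ : Renaming e d) (σ : Substitution B c d),
      (Φ.rename ρ).subst h σ = Φ.subst h fun q y => σ q (ρ q y) := by
  induction Φ with
  | var x => intros; rfl
  | app R hR Φ ih =>
    intro c d ρ σ
    simp only [Derivation.rename, Derivation.subst, ih]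
    congr 1
    funext k
    congr 1
    funext q y
    exact Substitution.lift_rename ρ σ _ q y

theorem Substitution.rename_lift {A : Type u} {B : Base A} {b c d : List A}
    (σ : Substitution B c d) (ρ : Renaming c b) (l : List A) : ∀ (p : A) (x : Var (l ++ d) p),
      (σ.lift l p x).rename (ρ.lift l)
        = Substitution.lift (fun q y => (σ q y).rename ρ) l p x := by
  induction l with
  | nil => intro p x; rfl
  | cons a l ih =>
    intro p x
    cases x with
    | here => rfl
    | there x =>
      simp only [Substitution.lift, ← ih, Derivation.rename_rename]
      rfl

theorem Derivation.rename_subst {A : Type u} {B C : Base A} (h : C ⊆ B) {d : List A} {p : A}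
    (Φ : Derivation C d p) : ∀ {b c : List A} (σ : Substitution B c d) (ρ : Renaming c b),
      (Φ.subst h σ).rename ρ = Φ.subst h fun q y => (σ q y).rename ρ := by
  induction Φ with
  | var x => intros; rfl
  | app R hR Φ ih =>
    intro b c σ ρ
    simp only [Derivation.rename, Derivation.subst, ih]
    congr 1
    funext k
    congr 1
    funext q y
    exact Substitution.rename_lift σ ρ _ q y

theorem Substitution.subst_lift {A : Type u} {B C : Base A} (h : C ⊆ B) {c d e : List A}
    (τ : Substitution C d e) (σ : Substitution B c d) (l : List A) :
    ∀ (p : A) (x : Var (l ++ e) p),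
      (τ.lift l p x).subst h (σ.lift l)
        = Substitution.lift (fun q y => (τ q y).subst h σ) l p x := by
  induction l with
  | nil => intro p x; rfl
  | cons a l ih =>
    intro p x
    cases x with
    | here => rfl
    | there x =>
      simp only [Substitution.lift, ← ih, Derivation.subst_rename, Derivation.rename_subst]
      rfl

/-- Substitution is associative. -/
theorem Derivation.subst_subst {A : Type u} {B C D : Base A} (h : C ⊆ B) (h' : D ⊆ C)
    {e : List A} {p : A} (Φ : Derivation D e p) :
    ∀ {c d : List A} (τ : Substitution C d e) (σ : Substitution B c d),
      (Φ.subst h' τ).subst h σ = Φ.subst (h'.trans h) fun q y => (τ q y).subst h σ := by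
  induction Φ with
  | var x => intros; rfl
  | app R hR Φ ih =>
    intro c d τ σ
    simp only [Derivation.subst, ih]
    congr 1
    funext k
    congr 1
    funext q y
    exact Substitution.subst_lift h τ σ _ q y

theorem Substitution.lift_var {A : Type u} {B : Base A} {c : List A} (l : List A) :
    ∀ (p : A) (x : Var (l ++ c) p),
      Substitution.lift (B := B) (fun _ (y : Var c _) => .var y) l p x = .var x := by
  induction l with
  | nil => intro p x; rfl
  | cons a l ih =>
    intro p x
    cases x with
    | here => rfl
    | there x => simp only [Substitution.lift, ih, Derivation.rename]

theorem Derivation.subst_var {A : Type u} {B : Base A} {c : List A} {p : A}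
    (Φ : Derivation B c p) : Φ.subst subset_rfl (fun _ x => .var x) = Φ := by
  induction Φ with
  | var x => rfl
  | app R hR Φ ih =>
    simp only [Derivation.subst]
    congr 1
    funext k
    refine Eq.trans ?_ (ih k)
    congr 1
    funext q y
    exact Substitution.lift_var _ q y

/-! ### The category of worlds -/

/-- Worlds: pairs of a base and a context. -/
structure World (A : Type u) : Type u where
  base : Base A
  ctx : List A

/-- A morphism from `(B, X : P)` to `(C, Y : Q)`: an inclusion `C ⊆ B` and, for every variable of
`Y : Q`, a derivation in `B` of its atom from `X : P`. -/
@[ext]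
structure World.Hom {A : Type u} (v w : World A) : Type u where
  base_subset : w.base ⊆ v.base
  terms : Substitution v.base v.ctx w.ctx

open CategoryTheory

/-- The category `𝒲`; composition is simultaneous substitution. -/
noncomputable instance World.category (A : Type u) : Category.{u} (World A) where
  Hom v w := World.Hom v w
  id _ := { base_subset := subset_rfl, terms := fun _ x => .var x }
  comp f g :=
    { base_subset := g.base_subset.trans f.base_subset
      terms := fun p x => (g.terms p x).subst f.base_subset f.terms }
  id_comp f := World.Hom.ext (funext fun p => funext fun x => (f.terms p x).subst_var)
  comp_id _ := rfl
  assoc f g h := World.Hom.ext (funext fun p => funext fun x =>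
    ((h.terms p x).subst_subst f.base_subset g.base_subset g.terms f.terms).symm)

/-- Presheaves of sets on `𝒲`. -/
abbrev Presheaf (A : Type u) : Type (u + 1) := (World A)ᵒᵖ ⥤ Type u

/-! ### The interpretation -/

/-- The interpretation of an atom `p`: the derivations of `p`, acted upon by substitution. -/
noncomputable def atomPresheaf {A : Type u} (p : A) : Presheaf A where
  obj w := Derivation w.unop.base w.unop.ctx p
  map f := ↾fun Φ => Derivation.subst f.unop.base_subset f.unop.terms Φ
  map_id w := by
    ext Φ
    exact Derivation.subst_var Φ
  map_comp f g := by
    ext Φ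
    exact (Derivation.subst_subst g.unop.base_subset f.unop.base_subset Φ
      f.unop.terms g.unop.terms).symm

/-- The exponential presheaf, with values `(F ⊃ G)(w) = Nat(Hom(-, w) × F, G)`. -/
noncomputable def expPresheaf {A : Type u} (F G : Presheaf A) : Presheaf A where
  obj w := FunctorToTypes.prod (yoneda.obj w.unop) F ⟶ G
  map f := ↾fun η =>
    FunctorToTypes.prod.lift (FunctorToTypes.prod.fst ≫ yoneda.map f.unop)
      FunctorToTypes.prod.snd ≫ η
  map_id w := by
    ext η : 3
    rw [unop_id, yoneda.map_id, Category.comp_id]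
    rfl
  map_comp f g := by
    ext η : 3
    rw [unop_comp, yoneda.map_comp]
    rfl

/-- The universal quantification `∀_𝒜 K` over atoms of a family `K` of presheaves: its value at `w`
consists of a natural transformation `Hom(-, w) ⟶ K p` for every atom `p`. -/
noncomputable def forallPresheaf {A : Type u} (K : A → Presheaf A) : Presheaf A where
  obj w := ∀ p : A, yoneda.obj w.unop ⟶ K p
  map f := ↾fun η p => yoneda.map f.unop ≫ η p
  map_id w := by
    ext η : 3
    funext p
    simp
  map_comp f g := by
    ext η : 3
    funext p
    simp

/-- The interpretation `⟦φ⟧ : 𝒲ᵒᵖ ⥤ Set` of a formula. -/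
noncomputable def sem {A : Type u} : Formula A → Presheaf A
  | .atom p => atomPresheaf p
  | .bot => forallPresheaf fun p => atomPresheaf p
  | .and φ ψ => FunctorToTypes.prod (sem φ) (sem ψ)
  | .or φ ψ => forallPresheaf fun p =>
      expPresheaf (expPresheaf (sem φ) (atomPresheaf p))
        (expPresheaf (expPresheaf (sem ψ) (atomPresheaf p)) (atomPresheaf p))
  | .imp φ ψ => expPresheaf (sem φ) (sem ψ)

/-- The interpretation `⟦Γ⟧` of a set of formulae: the (component-wise) product of the
interpretations of its members. -/
noncomputable def semSet {A : Type u} (Γ : Set (Formula A)) : Presheaf A where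
  obj w := ∀ ψ : Γ, (sem ψ.1).obj w
  map f := ↾fun x ψ => (sem ψ.1).map f (x ψ)
  map_id w := by
    ext x : 3
    funext ψ
    simp
  map_comp f g := by
    ext x : 3
    funext ψ
    simp

/-- Categorical base-extension validity `Γ ⊨ φ`. -/
def Entails {A : Type u} (Γ : Set (Formula A)) (φ : Formula A) : Prop :=
  Nonempty (semSet Γ ⟶ sem φ)

end CatPTS

namespace CatPTS

open CategoryTheory Opposite

/-! ### Natural deduction and decodings of atoms -/

/-! Name each subformula `χ` of `Γ` and `φ` by an atom `code χ`, with atoms naming themselves; this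
is possible since there are infinitely many atoms and finitely many subformulae (`exists_coding`).
Let N be the base of all atomic rules that become admissible in NJ after decoding. Derivations in N
decode to NJ proofs (`Derivation.nj`).

Conversely, N contains the coded introduction and elimination rules, and these give maps in both
directions between `sem χ` and the derivations of `code χ`, natural over all worlds whose base
contains N (`le_code`). Naturality is what allows such maps to be curried into elements of
exponentials, hence the induction on `χ` to pass through implication and disjunction.

At the world formed by N and the codes of `Γ`, the variables yield an element of the interpretation
of `Γ`. The given transformation sends it to an element for `φ`, which becomes a derivation of `code
φ` and decodes to a proof of `φ`. -/

theorem NJ.mono {A : Type u} {Γ : Set (Formula A)} {φ : Formula A} (h : NJ Γ φ) :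
    ∀ {Δ : Set (Formula A)}, Γ ⊆ Δ → NJ Δ φ := by
  induction h with
  | ax h => exact fun hs => .ax (hs h)
  | botE _ ih => exact fun hs => .botE (ih hs)
  | andI _ _ ih₁ ih₂ => exact fun hs => .andI (ih₁ hs) (ih₂ hs)
  | andE₁ _ ih => exact fun hs => .andE₁ (ih hs)
  | andE₂ _ ih => exact fun hs => .andE₂ (ih hs)
  | orI₁ _ ih => exact fun hs => .orI₁ (ih hs)
  | orI₂ _ ih => exact fun hs => .orI₂ (ih hs)
  | orE _ _ _ ih ih₁ ih₂ =>
    exact fun hs => .orE (ih hs) (ih₁ (Set.insert_subset_insert hs))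
      (ih₂ (Set.insert_subset_insert hs))
  | impI _ ih => exact fun hs => .impI (ih (Set.insert_subset_insert hs))
  | impE _ _ ih₁ ih₂ => exact fun hs => .impE (ih₁ hs) (ih₂ hs)

/-- The base of all atomic rules that are admissible in NJ when atoms are read as formulae
through `dec`. -/
def soundBase {A : Type u} (dec : A → Formula A) : Base A :=
  {R | ∀ Γ : Set (Formula A),
    (∀ P ∈ R.premises, NJ (Γ ∪ Set.image dec (P.1 : Set A)) (dec P.2)) → NJ Γ (dec R.conclusion)}

theorem Var.mem {A : Type u} {c : List A} {p : A} (x : Var c p) : p ∈ c := by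
  induction x with
  | here => exact List.mem_cons_self
  | there _ ih => exact List.mem_cons_of_mem _ ih

theorem Var.nonempty_of_mem {A : Type u} {c : List A} {p : A} (h : p ∈ c) :
    Nonempty (Var c p) := by
  induction c with
  | nil => cases h
  | cons a c ih =>
    cases h with
    | head => exact ⟨.here⟩
    | tail _ h => exact (ih h).map .there

/-- Membership of a rule in `soundBase` is exactly the induction step, instantiated at the decoded
context. -/
theorem Derivation.nj {A : Type u} {dec : A → Formula A} {c : List A} {p : A}
    (Φ : Derivation (soundBase dec) c p) : NJ (Set.image dec {q | q ∈ c}) (dec p) := by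
  induction Φ with
  | var x => exact .ax ⟨_, x.mem, rfl⟩
  | @app c R hR Φ ih =>
    refine hR _ fun P hP => ?_
    obtain ⟨k, rfl⟩ := List.get_of_mem hP
    refine (ih k).mono ?_
    rintro _ ⟨q, hq, rfl⟩
    rcases List.mem_append.1 hq with h | h
    · exact .inr ⟨q, Finset.mem_toList.1 h, rfl⟩
    · exact .inl ⟨q, h, rfl⟩

/-! ### Extending the context of a world -/

/-- A variable of the left part of a concatenated context. -/
def Var.inl {A : Type u} (c : List A) : ∀ {l : List A} {p : A}, Var l p → Var (l ++ c) p
  | _, _, .here => .here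
  | _, _, .there x => .there (x.inl c)

/-- A variable of the right part of a concatenated context. -/
def Var.inr {A : Type u} {c : List A} {p : A} (x : Var c p) : ∀ l : List A, Var (l ++ c) p
  | [] => x
  | _ :: l => .there (x.inr l)

theorem Derivation.rename_eq_subst {A : Type u} {B : Base A} {c d : List A} {p : A}
    (ρ : Renaming c d) (Φ : Derivation B c p) :
    Φ.rename ρ = Φ.subst subset_rfl fun q x => .var (ρ q x) := by
  rw [← (Φ.rename ρ).subst_var, Derivation.subst_rename]

/-- Gives the naturality of evaluation at a fresh variable in `Le.eval_var`. -/
theorem Substitution.lift_inl {A : Type u} {B : Base A} {c d : List A} (σ : Substitution B c d)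
    {l : List A} {p : A} (x : Var l p) : σ.lift l p (x.inl d) = .var (x.inl c) := by
  induction x with
  | here => rfl
  | there x ih => simp only [Var.inl, Substitution.lift, ih, Derivation.rename]

theorem Substitution.lift_inr {A : Type u} {B : Base A} {c d : List A} (σ : Substitution B c d)
    {p : A} (x : Var d p) (l : List A) :
    σ.lift l p (x.inr l) = (σ p x).rename fun _ y => y.inr l := by
  induction l with
  | nil =>
    exact (((σ p x).rename_eq_subst _).trans (σ p x).subst_var).symm
  | cons a l ih => simp only [Var.inr, Substitution.lift, ih, Derivation.rename_rename]

/-- The extension of the context of a world by the atoms `l`, as an endofunctor. -/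
noncomputable def World.extend {A : Type u} (l : List A) : World A ⥤ World A where
  obj w := ⟨w.base, l ++ w.ctx⟩
  map f := { base_subset := f.base_subset, terms := f.terms.lift l }
  map_id _ := World.Hom.ext (funext fun p => funext fun x => Substitution.lift_var l p x)
  map_comp f g := World.Hom.ext (funext fun p => funext fun x =>
    (Substitution.subst_lift f.base_subset g.terms f.terms l p x).symm)

/-- The projection from an extended context. -/
noncomputable def World.proj {A : Type u} (l : List A) : World.extend l ⟶ 𝟭 (World A) where
  app _ := { base_subset := subset_rfl, terms := fun _ x => .var (x.inr l) }
  naturality _ _ f := World.Hom.ext (funext fun _ => funext fun x =>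
    (Substitution.lift_inr f.terms x l).trans (Derivation.rename_eq_subst _ _))

/-- The presheaf `w ↦ F (w, l)`. -/
noncomputable abbrev shift {A : Type u} (l : List A) (F : Presheaf A) : Presheaf A :=
  (World.extend l).op ⋙ F

/-- Used with `f` an identity for modus ponens, and with `f` a context projection for evaluation at
a fresh variable. -/
theorem exp_naturality {A : Type u} {F G : Presheaf A} {u v w : World A}
    (η : FunctorToTypes.prod (yoneda.obj w) F ⟶ G) (g : u ⟶ v) (f : v ⟶ w) (x : F.obj (op v)) :
    η.app (op u) (g ≫ f, F.map g.op x) = G.map g.op (η.app (op v) (f, x)) := by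
  let y : (FunctorToTypes.prod (yoneda.obj w) F).obj (op v) := (f, x)
  exact NatTrans.naturality_apply η g.op y

/-! ### Maps of presheaves over the worlds that extend a given base -/

/-- `Le N F G`: there is a map from `F` to `G`, natural on the worlds whose base contains `N`. -/
def Le {A : Type u} (N : Base A) (F G : Presheaf A) : Prop :=
  ∃ η : ∀ w : World A, N ⊆ w.base → F.obj (op w) → G.obj (op w),
    ∀ (v w : World A) (f : v ⟶ w) (hv : N ⊆ v.base) (hw : N ⊆ w.base) (x : F.obj (op w)),
      η v hv (F.map f.op x) = G.map f.op (η w hw x)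

namespace Le

variable {A : Type u} {N : Base A} {F G H : Presheaf A}

theorem of_hom (η : F ⟶ G) : Le N F G :=
  ⟨fun w _ => η.app (op w), fun _ _ f _ _ x => NatTrans.naturality_apply η f.op x⟩

theorem refl : Le N F F := of_hom (𝟙 F)

theorem trans : Le N F G → Le N G H → Le N F H := by
  rintro ⟨η, hη⟩ ⟨θ, hθ⟩
  refine ⟨fun w h x => θ w h (η w h x), fun v w f hv hw x => ?_⟩
  exact (congrArg (θ v hv) (hη v w f hv hw x)).trans (hθ v w f hv hw _)

theorem fst : Le N (FunctorToTypes.prod F G) F := of_hom FunctorToTypes.prod.fst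

theorem snd : Le N (FunctorToTypes.prod F G) G := of_hom FunctorToTypes.prod.snd

theorem pair : Le N H F → Le N H G → Le N H (FunctorToTypes.prod F G) := by
  rintro ⟨η, hη⟩ ⟨θ, hθ⟩
  exact ⟨fun w h x => (η w h x, θ w h x), fun v w f hv hw x =>
    Prod.ext (hη v w f hv hw x) (hθ v w f hv hw x)⟩

/-- A morphism `v ⟶ w` can only enlarge the base, so every world mapping to one above `N` is itself
above `N`. A map defined only on those worlds therefore suffices to build an element of the
exponential. -/
theorem curry : Le N (FunctorToTypes.prod H F) G → Le N H (expPresheaf F G) := by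
  rintro ⟨η, hη⟩
  refine ⟨fun w h x =>
    { app := fun v => ↾fun y => η v.unop (h.trans y.1.base_subset) (H.map y.1.op x, y.2)
      naturality := ?_ }, fun v w f hv hw x => ?_⟩
  · intro v v' g
    ext y
    refine Eq.trans ?_ (hη v'.unop v.unop g.unop
      (h.trans (g.unop ≫ y.1).base_subset) (h.trans y.1.base_subset) (H.map y.1.op x, y.2))
    exact congrArg (fun z => η v'.unop _ (z, F.map g y.2))
      (Functor.map_comp_apply H y.1.op g x)
  · refine NatTrans.ext (funext fun u => ?_)
    ext y
    exact congrArg (fun z => η u.unop _ (z, y.2))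
      (Functor.map_comp_apply H f.op y.1.op x).symm

theorem mp : Le N H (expPresheaf F G) → Le N H F → Le N H G := by
  rintro ⟨η, hη⟩ ⟨θ, hθ⟩
  refine ⟨fun w h x => (η w h x).app (op w) (𝟙 w, θ w h x), fun v w f hv hw x => ?_⟩
  -- Restricting an element of the exponential along `f` precomposes its first argument with `f`.
  have h₁ : (η v hv (H.map f.op x)).app (op v) (𝟙 v, θ v hv (H.map f.op x)) =
      (η w hw x).app (op v) (𝟙 v ≫ f, θ v hv (H.map f.op x)) := by
    rw [hη v w f hv hw]
    rfl
  refine h₁.trans (Eq.trans ?_ (exp_naturality (η w hw x) f (𝟙 w) (θ w hw x)))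
  exact congrArg ((η w hw x).app (op v)) (Prod.ext (Category.id_comp f) (hθ v w f hv hw x))

theorem forall_intro {K : A → Presheaf A} : (∀ p, Le N H (K p)) → Le N H (forallPresheaf K) := by
  intro h
  choose η hη using h
  refine ⟨fun w h x p =>
    { app := fun v => ↾fun y => η p v.unop (h.trans y.base_subset) (H.map y.op x)
      naturality := ?_ }, fun v w f hv hw x => ?_⟩
  · intro v v' g
    ext y
    refine Eq.trans ?_ (hη p v'.unop v.unop g.unop
      (h.trans (g.unop ≫ y).base_subset) (h.trans y.base_subset) (H.map y.op x))
    exact congrArg (η p v'.unop _) (Functor.map_comp_apply H y.op g x)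
  · refine funext fun p => NatTrans.ext (funext fun u => ?_)
    ext y
    exact congrArg (η p u.unop _) (Functor.map_comp_apply H f.op y.op x).symm

theorem forall_elim {K : A → Presheaf A} (p : A) : Le N (forallPresheaf K) (K p) := by
  refine ⟨fun w _ x => (x p).app (op w) (𝟙 w), fun v w f hv hw x => ?_⟩
  refine Eq.trans ?_ (NatTrans.naturality_apply (x p) f.op (𝟙 w))
  exact congrArg ((x p).app (op v)) (Category.id_comp f)

/-- Weakening. -/
theorem weaken (l : List A) : Le N F (shift l F) := by
  refine of_hom { app := fun w => F.map ((World.proj l).app w.unop).op, naturality := ?_ }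
  intro w v f
  refine (F.map_comp _ _).symm.trans (Eq.trans ?_ (F.map_comp _ _))
  exact congrArg (fun g => F.map g.op) ((World.proj l).naturality f.unop).symm

/-- A function on derivations of `a` can be evaluated at a new variable of type `a`. -/
theorem eval_var {l : List A} {a : A} (ha : a ∈ l) :
    Le N (expPresheaf (atomPresheaf a) G) (shift l G) := by
  obtain ⟨z⟩ := Var.nonempty_of_mem ha
  refine ⟨fun w _ η => η.app (op ((World.extend l).obj w))
    ((World.proj l).app w, Derivation.var (z.inl w.ctx)), fun v w f hv hw η => ?_⟩
  refine Eq.trans ?_ (exp_naturality η ((World.extend l).map f)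
    ((World.proj l).app w) (Derivation.var (z.inl w.ctx)))
  exact congrArg (η.app (op ((World.extend l).obj v)))
    (Prod.ext ((World.proj l).naturality f).symm (Substitution.lift_inl f.terms z).symm)

/-- Application of an atomic rule. -/
theorem rule {R : AtomicRule A} (hR : R ∈ N)
    (h : ∀ P ∈ R.premises, Le N H (shift P.1.toList (atomPresheaf P.2))) :
    Le N H (atomPresheaf R.conclusion) := by
  have h' := fun k => h _ (R.premises.get_mem k)
  choose η hη using h'
  refine ⟨fun w hw x => Derivation.app R (hw hR) fun k => η k w hw x, fun v w f hv hw x => ?_⟩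
  refine congrArg (Derivation.app R (hv hR)) (funext fun k => ?_)
  -- Substitution under a binder is by the lifted substitution, which is the action of
  -- `World.extend` on morphisms.
  exact hη k v w f hv hw x

end Le

/-! ### Coding formulae by atoms -/

/-- The set of subformulae of a formula. -/
def Formula.subs {A : Type u} : Formula A → Set (Formula A)
  | .atom p => {.atom p}
  | .bot => {.bot}
  | .and φ ψ => insert (.and φ ψ) (φ.subs ∪ ψ.subs)
  | .or φ ψ => insert (.or φ ψ) (φ.subs ∪ ψ.subs)
  | .imp φ ψ => insert (.imp φ ψ) (φ.subs ∪ ψ.subs)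

theorem Formula.finite_subs {A : Type u} (φ : Formula A) : φ.subs.Finite := by
  induction φ with
  | atom p => exact Set.finite_singleton _
  | bot => exact Set.finite_singleton _
  | and φ ψ h₁ h₂ => exact (h₁.union h₂).insert _
  | or φ ψ h₁ h₂ => exact (h₁.union h₂).insert _
  | imp φ ψ h₁ h₂ => exact (h₁.union h₂).insert _

theorem Formula.self_mem_subs {A : Type u} (φ : Formula A) : φ ∈ φ.subs := by
  cases φ <;> simp [Formula.subs]

/-- For finitely many formulae there is a coding by atoms that fixes atomic formulae. -/
theorem exists_coding {A : Type u} [Infinite A] (T : Set (Formula A)) (hT : T.Finite) :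
    ∃ (code : Formula A → A) (dec : A → Formula A),
      (∀ p, code (.atom p) = p) ∧ ∀ χ ∈ T, dec (code χ) = χ := by
  classical
  have hS : {p : A | Formula.atom p ∈ T}.Finite :=
    hT.preimage fun p _ q _ h => by injection h
  have : Infinite ↑({p : A | Formula.atom p ∈ T}ᶜ) := hS.infinite_compl.to_subtype
  -- Compound formulae get codes that avoid the atoms of `T`, so they cannot clash with atoms coding
  -- themselves.
  obtain ⟨g⟩ : Nonempty (T ↪ ↑({p : A | Formula.atom p ∈ T}ᶜ)) := by
    have := hT.to_subtype
    exact ⟨((Finite.equivFin T).toEmbedding.trans Fin.valEmbedding).trans (Infinite.natEmbedding _)⟩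
  let code : Formula A → A := fun χ =>
    match χ with
    | .atom p => p
    | χ => if h : χ ∈ T then (g ⟨χ, h⟩ : A) else Classical.arbitrary A
  have hcode : ∀ χ (h : χ ∈ T), (∃ p, χ = .atom p) ∨ code χ = g ⟨χ, h⟩ := by
    intro χ h
    cases χ with
    | atom p => exact .inl ⟨p, rfl⟩
    | _ => exact .inr (dif_pos h)
  have hinj : Set.InjOn code T := by
    intro χ hχ ψ hψ h
    rcases hcode χ hχ with ⟨p, rfl⟩ | h₁ <;> rcases hcode ψ hψ with ⟨q, rfl⟩ | h₂
    · exact congrArg Formula.atom h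
    · exact absurd (show Formula.atom (g ⟨ψ, hψ⟩ : A) ∈ T from h₂ ▸ h ▸ hχ) (g ⟨ψ, hψ⟩).2
    · exact absurd (show Formula.atom (g ⟨χ, hχ⟩ : A) ∈ T from h₁ ▸ h ▸ hψ) (g ⟨χ, hχ⟩).2
    · have := g.injective (Subtype.ext (h₁.symm.trans (h.trans h₂)))
      exact congrArg Subtype.val this
  have : Nonempty (Formula A) := ⟨.bot⟩
  exact ⟨code, Function.invFunOn code T, fun _ => rfl, fun χ hχ => hinj.leftInvOn_invFunOn hχ⟩

/-- Over the base of sound rules, a coded formula is interchangeable with its code. -/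
theorem le_code {A : Type u} {code : Formula A → A} {dec : A → Formula A}
    (hatom : ∀ p, code (.atom p) = p) (χ : Formula A) (hdec : ∀ ψ ∈ χ.subs, dec (code ψ) = ψ) :
    Le (soundBase dec) (sem χ) (atomPresheaf (code χ)) ∧
      Le (soundBase dec) (atomPresheaf (code χ)) (sem χ) := by
  have hχ := hdec χ χ.self_mem_subs
  induction χ with
  | atom p =>
    rw [hatom]
    exact ⟨Le.refl, Le.refl⟩
  | bot =>
    refine ⟨Le.forall_elim _, Le.forall_intro fun p => ?_⟩
    -- The atom `p` need not be a code: ⊥-elimination reaches any formula, in particular `dec p`.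
    refine Le.rule (R := ⟨[(∅, code .bot)], p⟩) (fun Γ h => ?_) ?_
    · simp only [List.forall_mem_singleton, hχ] at h
      exact .botE (by simpa using h)
    · simpa only [List.forall_mem_singleton] using Le.weaken _
  | and φ ψ ihφ ihψ =>
    have hφ := fun θ h => hdec θ (.inr (.inl h))
    have hψ := fun θ h => hdec θ (.inr (.inr h))
    specialize ihφ hφ (hφ _ φ.self_mem_subs)
    specialize ihψ hψ (hψ _ ψ.self_mem_subs)
    have eφ := hφ _ φ.self_mem_subs
    have eψ := hψ _ ψ.self_mem_subs
    refine ⟨?_, Le.pair (Le.trans ?_ ihφ.2) (Le.trans ?_ ihψ.2)⟩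
    · refine Le.rule (R := ⟨[(∅, code φ), (∅, code ψ)], code (.and φ ψ)⟩) (fun Γ h => ?_) ?_
      · simp only [List.forall_mem_cons, eφ, eψ, Finset.coe_empty, Set.image_empty,
          Set.union_empty] at h
        rw [hχ]
        exact .andI h.1 h.2.1
      · simp only [List.forall_mem_cons, List.not_mem_nil, IsEmpty.forall_iff, implies_true,
          and_true]
        exact ⟨(Le.fst.trans ihφ.1).trans (Le.weaken _), (Le.snd.trans ihψ.1).trans (Le.weaken _)⟩
    · refine Le.rule (R := ⟨[(∅, code (.and φ ψ))], code φ⟩) (fun Γ h => ?_) ?_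
      · simp only [List.forall_mem_singleton, hχ, Finset.coe_empty, Set.image_empty,
          Set.union_empty] at h
        rw [eφ]
        exact .andE₁ h
      · simpa only [List.forall_mem_singleton] using Le.weaken _
    · refine Le.rule (R := ⟨[(∅, code (.and φ ψ))], code ψ⟩) (fun Γ h => ?_) ?_
      · simp only [List.forall_mem_singleton, hχ, Finset.coe_empty, Set.image_empty,
          Set.union_empty] at h
        rw [eψ]
        exact .andE₂ h
      · simpa only [List.forall_mem_singleton] using Le.weaken _
  | or φ ψ ihφ ihψ =>
    have hφ := fun θ h => hdec θ (.inr (.inl h))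
    have hψ := fun θ h => hdec θ (.inr (.inr h))
    specialize ihφ hφ (hφ _ φ.self_mem_subs)
    specialize ihψ hψ (hψ _ ψ.self_mem_subs)
    have eφ := hφ _ φ.self_mem_subs
    have eψ := hψ _ ψ.self_mem_subs
    constructor
    · refine Le.mp (Le.mp (Le.forall_elim (code (.or φ ψ))) (Le.curry (Le.snd.trans ?_)))
        (Le.curry (Le.snd.trans ?_))
      · refine ihφ.1.trans (Le.rule (R := ⟨[(∅, code φ)], code (.or φ ψ)⟩) (fun Γ h => ?_) ?_)
        · simp only [List.forall_mem_singleton, eφ, Finset.coe_empty, Set.image_empty,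
            Set.union_empty] at h
          rw [hχ]
          exact .orI₁ h
        · simpa only [List.forall_mem_singleton] using Le.weaken _
      · refine ihψ.1.trans (Le.rule (R := ⟨[(∅, code ψ)], code (.or φ ψ)⟩) (fun Γ h => ?_) ?_)
        · simp only [List.forall_mem_singleton, eψ, Finset.coe_empty, Set.image_empty,
            Set.union_empty] at h
          rw [hχ]
          exact .orI₂ h
        · simpa only [List.forall_mem_singleton] using Le.weaken _
    · refine Le.forall_intro fun p => Le.curry (Le.curry ?_)
      -- Coded ∨-elimination, sound for arbitrary `p` because `dec p` can be any formula.
      refine Le.rule (R := ⟨[(∅, code (.or φ ψ)), ({code φ}, p), ({code ψ}, p)], p⟩)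
        (fun Γ h => ?_) ?_
      · simp only [List.forall_mem_cons, hχ, eφ, eψ, Finset.coe_empty, Set.image_empty,
          Set.union_empty, Finset.coe_singleton, Set.image_singleton, Set.union_singleton] at h
        exact .orE h.1 h.2.1 h.2.2.1
      · simp only [List.forall_mem_cons, List.not_mem_nil, IsEmpty.forall_iff, implies_true,
          and_true]
        refine ⟨(Le.fst.trans Le.fst).trans (Le.weaken _), ?_, ?_⟩
        -- Precomposition with `ihφ.2` turns the function on `sem φ` into one on derivations of
        -- `code φ`; its value at the discharged variable is the premise of the rule.
        · refine Le.trans (Le.curry ?_) (Le.eval_var (a := code φ) (by simp))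
          exact Le.mp (Le.fst.trans (Le.fst.trans Le.snd)) (Le.snd.trans ihφ.2)
        · refine Le.trans (Le.curry ?_) (Le.eval_var (a := code ψ) (by simp))
          exact Le.mp (Le.fst.trans Le.snd) (Le.snd.trans ihψ.2)
  | imp φ ψ ihφ ihψ =>
    have hφ := fun θ h => hdec θ (.inr (.inl h))
    have hψ := fun θ h => hdec θ (.inr (.inr h))
    specialize ihφ hφ (hφ _ φ.self_mem_subs)
    specialize ihψ hψ (hψ _ ψ.self_mem_subs)
    have eφ := hφ _ φ.self_mem_subs
    have eψ := hψ _ ψ.self_mem_subs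
    constructor
    · refine Le.rule (R := ⟨[({code φ}, code ψ)], code (.imp φ ψ)⟩) (fun Γ h => ?_) ?_
      · simp only [List.forall_mem_singleton, eφ, eψ, Finset.coe_singleton, Set.image_singleton,
          Set.union_singleton] at h
        rw [hχ]
        exact .impI h
      · simp only [List.forall_mem_singleton]
        refine Le.trans (Le.curry ?_) (Le.eval_var (a := code φ) (by simp))
        exact (Le.mp Le.fst (Le.snd.trans ihφ.2)).trans ihψ.1
    · refine Le.curry (Le.trans ?_ ihψ.2)
      refine Le.rule (R := ⟨[(∅, code φ), (∅, code (.imp φ ψ))], code ψ⟩) (fun Γ h => ?_) ?_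
      · simp only [List.forall_mem_cons, eφ, hχ, Finset.coe_empty, Set.image_empty,
          Set.union_empty] at h
        rw [eψ]
        exact .impE h.1 h.2.1
      · simp only [List.forall_mem_cons, List.not_mem_nil, IsEmpty.forall_iff, implies_true,
          and_true]
        exact ⟨(Le.snd.trans ihφ.1).trans (Le.weaken _), Le.fst.trans (Le.weaken _)⟩

end CatPTS

theorem mainTheorem2 {A : Type u} [Infinite A] (Γ : Set (CatPTS.Formula A)) (hΓ : Γ.Finite)
    (φ : CatPTS.Formula A) (h : CatPTS.Entails Γ φ) : CatPTS.NJ Γ φ := by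
  open CatPTS in
  obtain ⟨η⟩ := h
  obtain ⟨code, dec, hatom, hdec⟩ := exists_coding (φ.subs ∪ ⋃ ψ ∈ Γ, ψ.subs)
    (φ.finite_subs.union (hΓ.biUnion fun ψ _ => ψ.finite_subs))
  have hdecΓ : ∀ ψ ∈ Γ, ∀ χ ∈ ψ.subs, dec (code χ) = χ := fun ψ hψ χ hχ =>
    hdec χ (.inr (Set.mem_biUnion hψ hχ))
  let w : World A := ⟨soundBase dec, hΓ.toFinset.toList.map code⟩
  have hyp : ∀ ψ : Γ, Nonempty ((sem ψ.1).obj (.op w)) := fun ψ => by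
    obtain ⟨θ, -⟩ := (le_code hatom ψ.1 (hdecΓ ψ.1 ψ.2)).2
    obtain ⟨x⟩ : Nonempty (Var w.ctx (code ψ.1)) := Var.nonempty_of_mem
      (List.mem_map_of_mem (Finset.mem_toList.2 (hΓ.mem_toFinset.2 ψ.2)))
    exact ⟨θ w subset_rfl (Derivation.var x)⟩
  -- Naturality has served its purpose in the induction; only the component at `w` is needed.
  obtain ⟨θ, -⟩ := (le_code hatom φ fun χ hχ => hdec χ (.inl hχ)).1
  have Φ : Derivation (soundBase dec) w.ctx (code φ) :=
    θ w subset_rfl (η.app (.op w) fun ψ => (hyp ψ).some)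
  have := Φ.nj
  rw [hdec φ (.inl φ.self_mem_subs)] at this
  refine this.mono ?_
  rintro _ ⟨q, hq, rfl⟩
  obtain ⟨ψ, hψ, rfl⟩ := List.mem_map.1 hq
  have hψ' := hΓ.mem_toFinset.1 (Finset.mem_toList.1 hψ)
  rwa [hdecΓ ψ hψ' ψ ψ.self_mem_subs]
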